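/- All topological spaces are assumed to be Hausdorff. A topological semigroup is a topological space with a jointly continuous associative multiplication. A space is called pseudocompact if it is Tychonoff and every continuous real-valued function on it is bounded. A semigroup is called simple if it has no two-sided ideal (a nonempty subset $I$ with $SI\cup IS\subseteq I$) other than $S$ itself. For a group $H$, nonempty sets $X,Y$ and a map $\sigma:Y\times X\to H$, the Rees product $[X,H,Y]_\sigma$ is the set $X\times H\times Y$ with the multiplication $(x,h,y)\cdot(x',h',y')=(x,h\,\sigma(y,x')\,h',y')$. A topological semigroup $S$ is called a topological paragroup if, for some topological group $H$, some nonempty topological spaces $X,Y$ and some continuous map $\sigma:Y\times X\to H$, it is topologically isomorphic (by a semigroup isomorphism that is a homeomorphism) to $[X,H,Y]_\sigma$ endowed with the product topology. **Theorem.** Let $S$ be a topological semigroup whose square $S\times S$ is pseudocompact. Then $S$ is a topological paragroup if and only if $S$ is simple and contains an idempotent. -/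

import Mathlib

universe u v w

/-- A space is pseudocompact if it is Tychonoff and every continuous real-valued function on it
is bounded. -/
def IsPseudocompact (X : Type u) [TopologicalSpace X] : Prop :=
  T35Space X ∧ ∀ f : X → ℝ, Continuous f → ∃ C : ℝ, ∀ x, |f x| ≤ C

/-- A two-sided ideal of a semigroup: a nonempty subset absorbing multiplication on both sides. -/
def IsTwoSidedSemigroupIdeal {S : Type u} [Semigroup S] (I : Set S) : Prop :=
  I.Nonempty ∧ ∀ s : S, ∀ x ∈ I, s * x ∈ I ∧ x * s ∈ I

/-- A semigroup is simple if it has no proper two-sided ideal. -/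
def IsSimpleSemigroup (S : Type u) [Semigroup S] : Prop :=
  ∀ I : Set S, IsTwoSidedSemigroupIdeal I → I = Set.univ

/-- The underlying space `X × H × Y` of the Rees product of `H` over `X` and `Y` relative to the
sandwich map `σ`. -/
def ReesProduct {X : Type u} {H : Type v} {Y : Type w} (_σ : Y × X → H) : Type (max u v w) :=
  X × H × Y

namespace ReesProduct

variable {X : Type u} {H : Type v} {Y : Type w}

/-- The Rees product carries the product topology. -/
instance instTopologicalSpace [TopologicalSpace X] [TopologicalSpace H] [TopologicalSpace Y]
    (σ : Y × X → H) : TopologicalSpace (ReesProduct σ) :=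
  inferInstanceAs (TopologicalSpace (X × H × Y))

/-- The multiplication `(x, h, y) * (x', h', y') = (x, h * σ (y, x') * h', y')`. -/
instance instSemigroup [Group H] (σ : Y × X → H) : Semigroup (ReesProduct σ) where
  mul a b := ((a.1, a.2.1 * σ (a.2.2, b.1) * b.2.1, b.2.2) : X × H × Y)
  mul_assoc a b c := by
    change ((_, _, _) : X × H × Y) = (_, _, _)
    exact congrArg (fun h : H => ((a.1, h, c.2.2) : X × H × Y))
      (by change a.2.1 * σ (a.2.2, b.1) * b.2.1 * σ (b.2.2, c.1) * c.2.1
            = a.2.1 * σ (a.2.2, b.1) * (b.2.1 * σ (b.2.2, c.1) * c.2.1)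
          simp only [mul_assoc])

end ReesProduct

/-- `S` is a topological paragroup if it is topologically isomorphic to the Rees product of a
(Hausdorff) topological group `H` over nonempty Hausdorff spaces `X`, `Y` relative to a
continuous sandwich map. The spaces may be taken in the universe of `S`, since each of them embeds
in `X × H × Y`. -/
def IsTopologicalParagroup (S : Type u) [Semigroup S] [TopologicalSpace S] : Prop :=
  ∃ (X H Y : Type u) (_ : TopologicalSpace X) (_ : TopologicalSpace H) (_ : TopologicalSpace Y)
    (_ : Group H) (σ : Y × X → H),
    Nonempty X ∧ Nonempty Y ∧ T2Space X ∧ T2Space H ∧ T2Space Y ∧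
      IsTopologicalGroup H ∧ Continuous σ ∧ Nonempty (S ≃ₜ* ReesProduct σ)

open Topology Set Filter

/-! The analytic input is that, when X × Y is pseudocompact, the sections F x of a continuous real F
vary continuously with x in the uniform distance over Y (`eventually_forall_abs_sub_lt`); with X
pseudocompact, that distance is totally bounded. Applied to (x, y) ↦ f (x * y), this makes a monoid
with pseudocompact square Dedekind-finite and makes inversion continuous in a group. In a simple S
every a in e S e satisfies s * a * t = e for some s, t, so Dedekind finiteness turns a into a unit
and e S e is a topological group. With g the inverse of e s e in e S e, the identity s g s = s makes
s ↦ (s g, e s e, g s) a continuous inverse of (x, h, y) ↦ x h y. The converse is pure algebra. -/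

/-! ### Pseudocompact products -/

/-- Pseudocompactness passes to Tychonoff continuous images. -/
theorem IsPseudocompact.of_surjective {X : Type u} {Y : Type v} [TopologicalSpace X]
    [TopologicalSpace Y] (hX : IsPseudocompact X) [T35Space Y] {g : X → Y} (hg : Continuous g)
    (hs : Function.Surjective g) : IsPseudocompact Y := by
  refine ⟨inferInstance, fun f hf => ?_⟩
  obtain ⟨C, hC⟩ := hX.2 (f ∘ g) (hf.comp hg)
  exact ⟨C, hs.forall.2 hC⟩

/-- In a pseudocompact space, every sequence of nonempty open sets accumulates at some point. -/
theorem IsPseudocompact.exists_cluster {Z : Type u} [TopologicalSpace Z] (hZ : IsPseudocompact Z)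
    {O : ℕ → Set Z} (hO : ∀ n, IsOpen (O n)) (hne : ∀ n, (O n).Nonempty) :
    ∃ z, ∀ N ∈ 𝓝 z, {n | (O n ∩ N).Nonempty}.Infinite := by
  have := hZ.1
  by_contra! hcon
  have hlf : LocallyFinite O := fun z => by
    obtain ⟨N, hN, h⟩ := hcon z
    exact ⟨N, hN, by simpa using h⟩
  choose z hz using hne
  choose b hbc hb0 hb1 using fun n =>
    CompletelyRegularSpace.completely_regular_isOpen (z n) (O n) (hO n) (hz n)
  -- Bumps of height `n` at `z n`, vanishing off `O n`: if the `O n` were locally finite, their sum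
  -- would be continuous and unbounded.
  set g : ℕ → Z → ℝ := fun n x => n * (1 - (b n x : ℝ)) with hg
  have hsupp : ∀ n, Function.support (g n) ⊆ O n := fun n x hx => by
    by_contra hxO
    have : b n x = 1 := hb1 n hxO
    exact hx (by simp [hg, this])
  have hlg : LocallyFinite fun n => Function.support (g n) := hlf.subset hsupp
  have hcont : Continuous fun x => ∑ᶠ n, g n x :=
    continuous_finsum (fun n => by have := hbc n; fun_prop) hlg
  obtain ⟨C, hC⟩ := hZ.2 _ hcont
  obtain ⟨n, hn⟩ := exists_nat_gt C
  have h0 : ∀ i, 0 ≤ g i (z n) := fun i =>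
    mul_nonneg i.cast_nonneg (sub_nonneg.2 (b i (z n)).2.2)
  have h1 : g n (z n) ≤ ∑ᶠ i, g i (z n) :=
    single_le_finsum n (hlg.point_finite (z n)) h0
  have h2 : g n (z n) = n := by simp [hg, hb0]
  linarith [le_abs_self (∑ᶠ i, g i (z n)), hC (z n)]

/-- The sections of a continuous function on a pseudocompact product are equicontinuous. -/
theorem IsPseudocompact.eventually_forall_abs_sub_lt {X : Type u} {Y : Type v} [TopologicalSpace X]
    [TopologicalSpace Y] (h : IsPseudocompact (X × Y)) {F : X → Y → ℝ}
    (hF : Continuous fun p : X × Y => F p.1 p.2) (x₀ : X) {ε : ℝ} (hε : 0 < ε) :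
    ∀ᶠ x in 𝓝 x₀, ∀ y, |F x y - F x₀ y| < ε := by
  set G : X → Y → ℝ := fun x y => |F x y - F x₀ y| with hG
  have hGc : Continuous fun p : X × Y => G p.1 p.2 :=
    (hF.sub (hF.comp (f := fun p : X × Y => (x₀, p.2)) (by fun_prop))).abs
  have hG0 : ∀ y, G x₀ y = 0 := fun y => by simp [hG]
  by_contra hcon
  -- If the claim fails, every neighbourhood of `x₀` yields a box where `G` is large and a smaller
  -- neighbourhood on which `G` is small over the same `V`. Iterating gives boxes that accumulate at
  -- some (x, y).
  have step : ∀ W : TopologicalSpace.OpenNhdsOf x₀, ∃ (U : Set X) (V : Set Y)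
      (W' : TopologicalSpace.OpenNhdsOf x₀), IsOpen U ∧ IsOpen V ∧ U.Nonempty ∧ V.Nonempty ∧
        U ⊆ W ∧ W' ≤ W ∧ (∀ x ∈ U, ∀ y ∈ V, 3 / 4 * ε < G x y) ∧
        ∀ x ∈ W', ∀ y ∈ V, G x y < ε / 2 := by
    intro W
    obtain ⟨x, hxW, y, hxy⟩ : ∃ x ∈ W, ∃ y, ε ≤ G x y := by
      by_contra! hW
      exact hcon (mem_of_superset (W.isOpen.mem_nhds W.mem) fun x hx y => hW x hx y)
    have h1 : {p : X × Y | 3 / 4 * ε < G p.1 p.2} ∈ 𝓝 (x, y) :=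
      (isOpen_lt continuous_const hGc).mem_nhds (by simp only [mem_ofPred_eq]; linarith)
    have h2 : {p : X × Y | G p.1 p.2 < ε / 2} ∈ 𝓝 (x₀, y) :=
      (isOpen_lt hGc continuous_const).mem_nhds (by simp only [mem_ofPred_eq, hG0]; linarith)
    obtain ⟨U, V, hU, hxU, hV, hyV, hUV⟩ := mem_nhds_prod_iff'.1 h1
    obtain ⟨A, B, hA, hxA, hB, hyB, hAB⟩ := mem_nhds_prod_iff'.1 h2
    refine ⟨U ∩ W, V ∩ B, ⟨⟨A, hA⟩, hxA⟩ ⊓ W, hU.inter W.isOpen, hV.inter hB, ⟨x, hxU, hxW⟩,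
      ⟨y, hyV, hyB⟩, inter_subset_right, inf_le_right, fun a ha b hb => ?_, fun a ha b hb => ?_⟩
    · exact hUV (mk_mem_prod ha.1 hb.1)
    · exact hAB (mk_mem_prod ha.1 hb.2)
  choose U V W' hU hV hUne hVne hUW hW' hlarge hsmall using step
  let w : ℕ → TopologicalSpace.OpenNhdsOf x₀ := fun n => W'^[n] ⊤
  have hw : ∀ n, w (n + 1) = W' (w n) := fun n => Function.iterate_succ_apply' _ _ _
  have hanti : Antitone w := antitone_nat_of_succ_le fun n => by rw [hw]; exact hW' _
  obtain ⟨⟨x, y⟩, hz⟩ := h.exists_cluster (O := fun n => U (w n) ×ˢ V (w n))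
    (fun n => (hU _).prod (hV _)) (fun n => (hUne _).prod (hVne _))
  -- Each later `U` lies inside `W' (w n)`, so the bound ε / 2 over `V (w n)` passes to the limit
  -- `x`.
  have hxcl : ∀ n, x ∈ closure (W' (w n) : Set X) := fun n => by
    rw [mem_closure_iff_nhds]
    intro A hA
    obtain ⟨m, ⟨⟨a, b⟩, hab, haA, -⟩, hm⟩ :=
      (hz (A ×ˢ univ) (prod_mem_nhds hA univ_mem)).exists_gt n
    refine ⟨a, haA, ?_⟩
    rw [← hw]
    exact hanti (Nat.succ_le_of_lt hm) (hUW _ hab.1)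
  have hxs : ∀ n, ∀ b ∈ V (w n), G x b ≤ ε / 2 := fun n b hb =>
    closure_minimal (s := (W' (w n) : Set X)) (t := {a | G a b ≤ ε / 2})
      (fun a ha => (hsmall _ a ha b hb).le)
      (isClosed_le (hGc.comp (f := fun a => (a, b)) (by fun_prop)) continuous_const) (hxcl n)
  have hxy : 3 / 4 * ε ≤ G x y := by
    by_contra! hlt
    obtain ⟨m, ⟨a, b⟩, hab, hab'⟩ := (hz {p | G p.1 p.2 < 3 / 4 * ε}
      ((isOpen_lt hGc continuous_const).mem_nhds hlt)).nonempty
    exact (hlarge _ a hab.1 b hab.2).not_gt hab'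
  -- The gap between 3/4 and 1/2 gives the contradiction: `G x` exceeds ε / 2 near `y`, where some
  -- `V (w m)` has a point.
  have hN : {p : X × Y | ε / 2 < G p.1 p.2} ∈ 𝓝 (x, y) :=
    (isOpen_lt continuous_const hGc).mem_nhds (by simp only [mem_ofPred_eq]; linarith)
  obtain ⟨A, B, -, hxA, hB, hyB, hAB⟩ := mem_nhds_prod_iff'.1 hN
  obtain ⟨m, ⟨a, b⟩, hab, -, hbB⟩ :=
    (hz (univ ×ˢ B) (prod_mem_nhds univ_mem (hB.mem_nhds hyB))).nonempty
  exact (hxs m b hab.2).not_gt (hAB (mk_mem_prod hxA hbB))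

/-- The pseudometric of uniform distance between sections of a continuous function on a
pseudocompact product is totally bounded. -/
theorem IsPseudocompact.exists_lt_forall_abs_sub_lt {X : Type u} {Y : Type v} [TopologicalSpace X]
    [TopologicalSpace Y] (hX : IsPseudocompact X) (h : IsPseudocompact (X × Y)) {F : X → Y → ℝ}
    (hF : Continuous fun p : X × Y => F p.1 p.2) (x : ℕ → X) {ε : ℝ} (hε : 0 < ε) :
    ∃ m n, m < n ∧ ∀ y, |F (x m) y - F (x n) y| < ε := by
  have hev := fun x₀ => h.eventually_forall_abs_sub_lt hF x₀ (show 0 < ε / 4 by linarith)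
  obtain ⟨z, hz⟩ := hX.exists_cluster
    (O := fun n => interior {a | ∀ y, |F a y - F (x n) y| < ε / 4}) (fun n => isOpen_interior)
    (fun n => ⟨x n, mem_interior_iff_mem_nhds.2 (hev (x n))⟩)
  -- Two of the balls meet the ball around `z`; the chain x m, a, z, b, x n has four links, each
  -- shorter than ε / 4.
  have hinf := hz _ (hev z)
  obtain ⟨m, a, ha, ha'⟩ := hinf.nonempty
  obtain ⟨n, ⟨b, hb, hb'⟩, hmn⟩ := hinf.exists_gt m
  refine ⟨m, n, hmn, fun y => ?_⟩
  have h1 := abs_lt.1 (interior_subset ha y)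
  have h2 := abs_lt.1 (ha' y)
  have h3 := abs_lt.1 (interior_subset hb y)
  have h4 := abs_lt.1 (hb' y)
  exact abs_lt.2 ⟨by linarith [h1.1, h1.2, h2.1, h2.2, h3.1, h3.2, h4.1, h4.2],
    by linarith [h1.1, h1.2, h2.1, h2.2, h3.1, h3.2, h4.1, h4.2]⟩

theorem T35Space.of_prod_self {X : Type u} [TopologicalSpace X] [T35Space (X × X)] :
    T35Space X :=
  have h : IsEmbedding fun x : X => (x, x) :=
    .of_comp (by fun_prop) continuous_fst .id
  h.t35Space

theorem IsPseudocompact.of_prod_self {X : Type u} [TopologicalSpace X]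
    (h : IsPseudocompact (X × X)) : IsPseudocompact X :=
  have := h.1
  have : T35Space X := .of_prod_self
  h.of_surjective continuous_fst fun x => ⟨(x, x), rfl⟩

/-! ### Monoids and groups with pseudocompact square -/

/-- A topological monoid with pseudocompact square is Dedekind-finite. -/
theorem IsPseudocompact.mul_eq_one_symm {M : Type u} [Monoid M] [TopologicalSpace M]
    [ContinuousMul M] (h : IsPseudocompact (M × M)) {a b : M} (hab : a * b = 1) : b * a = 1 := by
  have hM := h.of_prod_self
  have := hM.1
  by_contra hne
  obtain ⟨f, hf, hf0, hf1⟩ :=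
    CompletelyRegularSpace.completely_regular (1 : M) {b * a} isClosed_singleton (Ne.symm hne)
  have hf1 : f (b * a) = 1 := hf1 rfl
  obtain ⟨m, n, hmn, hd⟩ := hM.exists_lt_forall_abs_sub_lt h (F := fun x y => (f (x * y) : ℝ))
    (by fun_prop) (fun n => a ^ n) (show (0 : ℝ) < 1 / 2 by norm_num)
  obtain ⟨k, rfl⟩ := Nat.exists_eq_add_of_lt hmn
  have hpow : ∀ m : ℕ, a ^ m * b ^ m = 1 := fun m => by
    induction m with
    | zero => simp
    | succ m ih => rw [pow_succ, pow_succ', mul_assoc, ← mul_assoc a, hab, one_mul, ih]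
  have e1 : a ^ (m + k + 1) * b ^ m = a ^ (k + 1) := by
    rw [show m + k + 1 = k + 1 + m by ring, pow_add, mul_assoc, hpow, mul_one]
  have e2 : a ^ (k + 1) * b = a ^ k := by rw [pow_succ, mul_assoc, hab, mul_one]
  -- Both test points yield `f (a ^ (k + 1))`, compared first with `f 1 = 0` and then with `f (b *
  -- a) = 1`; it cannot be within 1/2 of both.
  have d1 := hd (b ^ m)
  have d2 := hd (b ^ m * (b * a))
  simp only [← mul_assoc, hpow, e1, e2, one_mul] at d1 d2
  rw [← pow_succ, hf1] at d2
  rw [hf0] at d1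
  have d1 := abs_lt.1 d1
  have d2 := abs_lt.1 d2
  simp only [Set.Icc.coe_zero, Set.Icc.coe_one] at d1 d2
  linarith [d1.1, d2.2]

/-- A group with continuous multiplication and pseudocompact square is a topological group. -/
theorem IsPseudocompact.isTopologicalGroup {H : Type u} [Group H] [TopologicalSpace H]
    [ContinuousMul H] (h : IsPseudocompact (H × H)) : IsTopologicalGroup H := by
  have := h.of_prod_self.1
  have key : ContinuousAt (fun x : H => x⁻¹) 1 := by
    rw [ContinuousAt, inv_one, (nhds_basis_opens (1 : H)).tendsto_right_iff]
    rintro O ⟨h1, hO⟩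
    obtain ⟨f, hf, hf0, hf1⟩ := CompletelyRegularSpace.completely_regular_isOpen (1 : H) O hO h1
    filter_upwards [h.eventually_forall_abs_sub_lt (F := fun x y => (f (x * y) : ℝ))
      (by fun_prop) 1 one_pos] with x hx
    -- Testing the uniform estimate at y = x⁻¹ compares `f 1 = 0` with `f x⁻¹ = 1`.
    by_contra hxO
    have hfx : f x⁻¹ = 1 := hf1 hxO
    simpa [hf0, hfx] using hx x⁻¹
  refine { continuous_inv := continuous_iff_continuousAt.2 fun x₀ => ?_ }
  have h2 : ContinuousAt (fun x : H => x₀⁻¹ * (x * x₀⁻¹)⁻¹) x₀ :=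
    continuousAt_const.mul (ContinuousAt.comp (g := fun x : H => x⁻¹) (f := fun x => x * x₀⁻¹)
      (by simpa using key) (by fun_prop))
  simpa using h2

/-! ### Corners of simple semigroups -/

theorem IsSimpleSemigroup.exists_mul_mul_eq {S : Type u} [Semigroup S] (hS : IsSimpleSemigroup S)
    (a b : S) : ∃ s t, s * a * t = b := by
  have h : IsTwoSidedSemigroupIdeal {b | ∃ s t, s * a * t = b} := by
    refine ⟨⟨_, a, a, rfl⟩, ?_⟩
    rintro r _ ⟨s, t, rfl⟩
    exact ⟨⟨r * s, t, by simp only [mul_assoc]⟩, ⟨s, t * r, by simp only [mul_assoc]⟩⟩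
  exact (hS _ h).ge (mem_univ b)

section Corner

variable {S : Type u} [Semigroup S] {e : S}

/-- The corner `e S e` of a semigroup at an idempotent `e` is a monoid with identity `e`. -/
abbrev cornerMonoid (he : IsIdempotentElem e) : Monoid (Subsemigroup.corner e) where
  one := ⟨e, (Subsemigroup.mem_corner_iff he).2 ⟨he, he⟩⟩
  one_mul r := Subtype.ext ((Subsemigroup.mem_corner_iff he).1 r.2).1
  mul_one r := Subtype.ext ((Subsemigroup.mem_corner_iff he).1 r.2).2

/-- The group structure on the corner `e S e` when all its elements have left inverses. -/
noncomputable abbrev cornerGroup (he : IsIdempotentElem e)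
    (h : ∀ a : Subsemigroup.corner e, ∃ b : Subsemigroup.corner e, (b * a : S) = e) :
    Group (Subsemigroup.corner e) where
  __ := cornerMonoid he
  inv a := (h a).choose
  inv_mul_cancel a := Subtype.ext (h a).choose_spec

/-- The map s ↦ e s e carries S continuously onto the corner. -/
theorem IsPseudocompact.corner_prod_self [TopologicalSpace S] [ContinuousMul S]
    (hS : IsPseudocompact (S × S)) :
    IsPseudocompact (Subsemigroup.corner e × Subsemigroup.corner e) := by
  have := hS.1
  have : T35Space (Subsemigroup.corner e × Subsemigroup.corner e) :=
    (IsEmbedding.subtypeVal.prodMap IsEmbedding.subtypeVal).t35Space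
  let r : S → Subsemigroup.corner e := fun s => ⟨e * s * e, s, rfl⟩
  have hr : Continuous r := Continuous.subtype_mk (by fun_prop) _
  have hs : Function.Surjective r := by
    rintro ⟨_, s, rfl⟩
    exact ⟨s, rfl⟩
  exact hS.of_surjective (hr.prodMap hr) (hs.prodMap hs)

/-- In a simple semigroup with pseudocompact square, every idempotent is primitive. -/
theorem IsSimpleSemigroup.exists_corner_mul_eq [TopologicalSpace S] [ContinuousMul S]
    (hS : IsPseudocompact (S × S)) (hs : IsSimpleSemigroup S) (he : IsIdempotentElem e)
    (a : Subsemigroup.corner e) : ∃ b : Subsemigroup.corner e, (b * a : S) = e := by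
  let := cornerMonoid he
  obtain ⟨s, t, hst⟩ := hs.exists_mul_mul_eq (a : S) e
  obtain ⟨ha₁, ha₂⟩ := (Subsemigroup.mem_corner_iff he).1 a.2
  let s' : Subsemigroup.corner e := ⟨e * s * e, s, rfl⟩
  let t' : Subsemigroup.corner e := ⟨e * t * e, t, rfl⟩
  have h : s' * (a * t') = 1 := Subtype.ext <| by
    change e * s * e * (a * (e * t * e)) = e
    calc e * s * e * (a * (e * t * e)) = e * (s * (e * a * e) * t) * e := by simp only [mul_assoc]
      _ = e := by rw [ha₁, ha₂, hst, he, he]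
  -- Dedekind finiteness is used twice: to move `s'` to the right of `a * t'`, then to move `t' *
  -- s'` to the left of `a`.
  have h' : t' * s' * a = 1 := by
    refine (hS.corner_prod_self (e := e)).mul_eq_one_symm (a := a) (b := t' * s') ?_
    rw [← mul_assoc]
    exact hS.corner_prod_self.mul_eq_one_symm h
  exact ⟨t' * s', congrArg Subtype.val h'⟩

/-- Each element `s` of a simple semigroup is recovered from the inverse of `e s e` in `e S e`. -/
theorem IsSimpleSemigroup.mul_mul_eq_self (hs : IsSimpleSemigroup S) (he : IsIdempotentElem e)
    (h : ∀ a : Subsemigroup.corner e, ∃ b : Subsemigroup.corner e, (b * a : S) = e) {s g : S}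
    (hg₁ : g * e = g) (hg₂ : e * s * g = e) : s * g * s = s := by
  let := cornerGroup he h
  obtain ⟨a, b, rfl⟩ := hs.exists_mul_mul_eq e s
  have hee : ∀ x, e * (e * x) = e * x := fun x => by rw [← mul_assoc, he]
  let A : Subsemigroup.corner e := ⟨e * a * e, a, rfl⟩
  let B : Subsemigroup.corner e := ⟨e * b * g, (Subsemigroup.mem_corner_iff he).2
    ⟨by simp only [mul_assoc, hee], by rw [mul_assoc, hg₁]⟩⟩
  -- With s = a e b, the relation e s g = e factors in the group e S e as A B = 1; the reversed
  -- product B A = 1 is what appears inside s g s.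
  have h1 : A * B = 1 := Subtype.ext <| by
    change e * a * e * (e * b * g) = e
    simpa only [mul_assoc, hee] using hg₂
  have h2 : e * b * g * (e * a * e) = e := congrArg Subtype.val (mul_eq_one_comm.1 h1)
  calc a * e * b * g * (a * e * b) = a * (e * b * g * (e * a * e)) * b := by
        conv_lhs => rw [← hg₁]
        simp only [mul_assoc]
    _ = a * e * b := by rw [h2]

end Corner

/-! ### Rees coordinates -/

/-- A simple semigroup with pseudocompact square and an idempotent is a topological paragroup. -/
theorem IsSimpleSemigroup.isTopologicalParagroup {S : Type u} [Semigroup S] [TopologicalSpace S]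
    [ContinuousMul S] (hS : IsPseudocompact (S × S)) (hs : IsSimpleSemigroup S) {e : S}
    (he : IsIdempotentElem e) : IsTopologicalParagroup S := by
  have := hS.of_prod_self.1
  have hinv := hs.exists_corner_mul_eq hS he
  let G : Group (Subsemigroup.corner e) := cornerGroup he hinv
  have hG : IsTopologicalGroup (Subsemigroup.corner e) := hS.corner_prod_self.isTopologicalGroup
  -- `X` and `Y` consist of idempotents: x x = x (e x) = x e = x, and dually for `Y`.
  let X := {x : S // x * e = x ∧ e * x = e}
  let Y := {y : S // e * y = y ∧ y * e = e}
  let c : S → Subsemigroup.corner e := fun s => ⟨e * s * e, s, rfl⟩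
  have hc : Continuous c := Continuous.subtype_mk (by fun_prop) _
  let σ : Y × X → Subsemigroup.corner e := fun p => ⟨p.1 * p.2, (Subsemigroup.mem_corner_iff he).2
    ⟨by rw [← mul_assoc, p.1.2.1], by rw [mul_assoc, p.2.2.1]⟩⟩
  have hσ : Continuous σ := ((continuous_subtype_val.comp continuous_fst).mul
    (continuous_subtype_val.comp continuous_snd)).subtype_mk _
  let g : S → S := fun s => ((c s)⁻¹ : Subsemigroup.corner e)
  have hg : Continuous g := continuous_subtype_val.comp hc.inv
  have heg : ∀ s, e * g s = g s := fun s => ((Subsemigroup.mem_corner_iff he).1 (c s)⁻¹.2).1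
  have hge : ∀ s, g s * e = g s := fun s => ((Subsemigroup.mem_corner_iff he).1 (c s)⁻¹.2).2
  have hsg : ∀ s, e * s * g s = e := fun s => by
    have : e * s * e * g s = e := congrArg Subtype.val (mul_inv_cancel (c s))
    rwa [mul_assoc, heg] at this
  have hgs : ∀ s, g s * s * e = e := fun s => by
    have : g s * (e * s * e) = e := congrArg Subtype.val (inv_mul_cancel (c s))
    rwa [← mul_assoc, ← mul_assoc, hge] at this
  have hsgs : ∀ s, s * g s * s = s := fun s => hs.mul_mul_eq_self he hinv (hge s) (hsg s)
  let φ : ReesProduct σ ≃ₜ* S :=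
    { toFun := fun p => p.1 * p.2.1 * p.2.2
      invFun := fun s => ((⟨s * g s, by rw [mul_assoc, hge], by rw [← mul_assoc, hsg]⟩, c s,
        ⟨g s * s, by rw [← mul_assoc, heg], hgs s⟩) :
          X × Subsemigroup.corner e × Y)
      left_inv := by
        rintro ⟨⟨x, hx₁, hx₂⟩, ⟨h, hh⟩, ⟨y, hy₁, hy₂⟩⟩
        obtain ⟨h₁, h₂⟩ := (Subsemigroup.mem_corner_iff he).1 hh
        have hcs : c (x * h * y) = ⟨h, hh⟩ := Subtype.ext <| by
          change e * (x * h * y) * e = h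
          rw [mul_assoc, mul_assoc, hy₂, mul_assoc, h₂, ← mul_assoc, hx₂, h₁]
        have hhg : h * g (x * h * y) = e := by
          have : ((c (x * h * y) * (c (x * h * y))⁻¹ : Subsemigroup.corner e) : S) = e :=
            congrArg Subtype.val (mul_inv_cancel _)
          rw [← this]
          change _ = (c (x * h * y) : S) * _
          rw [hcs]
          change h * ((c (x * h * y))⁻¹ : Subsemigroup.corner e) = _
          rw [hcs]
        have hgh : g (x * h * y) * h = e := by
          have : (((c (x * h * y))⁻¹ * c (x * h * y) : Subsemigroup.corner e) : S) = e :=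
            congrArg Subtype.val (inv_mul_cancel _)
          rw [← this]
          change ((c (x * h * y))⁻¹ : Subsemigroup.corner e) * h = _ * (c (x * h * y) : S)
          rw [hcs]
        refine Prod.ext (Subtype.ext ?_) (Prod.ext hcs (Subtype.ext ?_))
        · change x * h * y * g (x * h * y) = x
          rw [← heg, mul_assoc, ← mul_assoc y, hy₂, heg, mul_assoc, hhg, hx₁]
        · change g (x * h * y) * (x * h * y) = y
          calc g (x * h * y) * (x * h * y) = g (x * h * y) * e * (x * h * y) := by rw [hge]
            _ = g (x * h * y) * (e * x) * h * y := by simp only [mul_assoc]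
            _ = y := by rw [hx₂, hge, hgh, hy₁]
      right_inv := fun s => by
        change s * g s * (e * s * e) * (g s * s) = s
        calc s * g s * (e * s * e) * (g s * s)
            = s * (g s * e) * s * (e * g s) * s := by simp only [mul_assoc]
          _ = s := by rw [hge, heg, hsgs, hsgs]
      map_mul' := by
        rintro ⟨x, h, y⟩ ⟨x', h', y'⟩
        change (x * (h * (y * x') * h') * y' : S) = x * h * y * (x' * h' * y')
        simp only [mul_assoc]
      continuous_toFun := by
        exact ((continuous_subtype_val.comp continuous_fst).mul (continuous_subtype_val.comp
          (continuous_fst.comp continuous_snd))).mul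
          (continuous_subtype_val.comp (continuous_snd.comp continuous_snd))
      continuous_invFun :=
        (Continuous.subtype_mk (continuous_id.mul hg) _).prodMk
          (hc.prodMk (Continuous.subtype_mk (hg.mul continuous_id) _)) }
  exact ⟨X, Subsemigroup.corner e, Y, inferInstance, inferInstance, inferInstance, G, σ,
    ⟨⟨e, he, he⟩⟩, ⟨⟨e, he, he⟩⟩, inferInstance, inferInstance, inferInstance, hG, hσ, ⟨φ.symm⟩⟩

/-- A Rees product over a group is simple. -/
theorem ReesProduct.isSimpleSemigroup {X : Type u} {H : Type v} {Y : Type w} [Group H]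
    (σ : Y × X → H) : IsSimpleSemigroup (ReesProduct σ) := by
  rintro I ⟨⟨⟨x, h, y⟩, ha⟩, hI⟩
  refine eq_univ_of_forall ?_
  rintro ⟨x', h', y'⟩
  -- The group entries of `l` and `r` cancel both sandwich factors and `h`, leaving `h'`.
  let l : ReesProduct σ := ((x', h' * (σ (y, x) * h)⁻¹, y) : X × H × Y)
  let a : ReesProduct σ := ((x, h, y) : X × H × Y)
  let r : ReesProduct σ := ((x, (σ (y, x))⁻¹, y') : X × H × Y)
  have hmem := (hI r _ (hI l _ ha).1).2
  have heq : ((x', h', y') : X × H × Y) = l * a * r := by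
    refine Prod.ext rfl (Prod.ext ?_ rfl)
    change h' = h' * (σ (y, x) * h)⁻¹ * σ (y, x) * h * σ (y, x) * (σ (y, x))⁻¹
    group
  exact heq ▸ hmem

theorem ReesProduct.exists_isIdempotentElem {X : Type u} {H : Type v} {Y : Type w} [Group H]
    [Nonempty X] [Nonempty Y] (σ : Y × X → H) : ∃ e : ReesProduct σ, IsIdempotentElem e := by
  obtain ⟨x⟩ := ‹Nonempty X›
  obtain ⟨y⟩ := ‹Nonempty Y›
  refine ⟨((x, (σ (y, x))⁻¹, y) : X × H × Y), Prod.ext rfl (Prod.ext ?_ rfl)⟩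
  change (σ (y, x))⁻¹ * σ (y, x) * (σ (y, x))⁻¹ = (σ (y, x))⁻¹
  group

theorem IsSimpleSemigroup.of_mulEquiv {S : Type u} {T : Type v} [Semigroup S] [Semigroup T]
    (φ : S ≃* T) (hT : IsSimpleSemigroup T) : IsSimpleSemigroup S := by
  rintro I ⟨⟨a, ha⟩, hI⟩
  refine eq_univ_of_forall fun b => ?_
  obtain ⟨s, t, h⟩ := hT.exists_mul_mul_eq (φ a) (φ b)
  have hb : φ.symm s * a * φ.symm t = b := φ.injective (by simpa using h)
  exact hb ▸ (hI _ _ (hI _ _ ha).1).2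

theorem mainTheorem3 (S : Type u) [Semigroup S] [TopologicalSpace S] [ContinuousMul S]
    (hS : IsPseudocompact (S × S)) :
    IsTopologicalParagroup S ↔ (IsSimpleSemigroup S ∧ ∃ e : S, IsIdempotentElem e) := by
  constructor
  · rintro ⟨X, H, Y, _, _, _, _, σ, _, _, -, -, -, -, -, ⟨φ⟩⟩
    obtain ⟨e, he⟩ := ReesProduct.exists_isIdempotentElem σ
    exact ⟨.of_mulEquiv φ.toMulEquiv (ReesProduct.isSimpleSemigroup σ), φ.symm e, he.map φ.symm⟩
  · rintro ⟨hs, e, he⟩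
    exact hs.isTopologicalParagroup hS he
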